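/- Let $n\ge 3$, put $\alpha=n-2$, and let $\eta\in\mathbb C^n$ with $|\eta|=1$, where $(z|w)=\sum_{i=1}^n z_i\overline{w_i}$ and $|z|^2=(z|z)$. For nonnegative integers $k,j$ let $\mathcal H^{(k,j)}$ be the space of complex polynomials $P(z,\bar z)$ on $\mathbb C^n$ that are bihomogeneous of degree $(k,j)$, i.e. $P(\lambda z,\bar\lambda\bar z)=\lambda^k\bar\lambda^{\,j}P(z,\bar z)$ for all $\lambda\in\mathbb C$, $z\in\mathbb C^n$, and harmonic, i.e. annihilated by the Euclidean Laplacian $\Delta=4\sum_{i=1}^n\frac{\partial^2}{\partial z_i\,\partial\bar z_i}$. Call $P\in\mathcal H^{(k,j)}$ zonal with pole $\eta$ if its restriction to the unit sphere is invariant under the isotropy group $\{U\in SU(n): U\eta=\eta\}$. Then for all nonnegative integers $k,j$ the expression $$\mathcal Z^{(k,j)}_\eta(z,\bar z)=(z|\eta)^k\,\overline{(z|\eta)}^{\,j}\;{}_2F_1\!\left(-k,\,-j;\,-\alpha-k-j;\ \frac{1}{|(\xi|\eta)|^2}\right),\qquad \xi=\frac{z}{|z|},\quad (z|\eta)\neq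 0,$$ is the restriction to $\{z:(z|\eta)\ne0\}$ of a nonzero polynomial in $z,\bar z$, again denoted $\mathcal Z^{(k,j)}_\eta$, which is a zonal element of $\mathcal H^{(k,j)}$ with pole $\eta$; and every zonal element of $\mathcal H^{(k,j)}$ with pole $\eta$ is a scalar multiple of $\mathcal Z^{(k,j)}_\eta$. Here ${}_2F_1(a,b;c;t)=\sum_{i\ge0}\frac{(a)_i(b)_i}{(c)_i}\frac{t^i}{i!}$, with $(r)_0=1$ and $(r)_i=r(r+1)\cdots(r+i-1)$ for $i\geq 1$, is a terminating series: only the terms with $i\le\min(k,j)$ are present. -/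

import Mathlib

open scoped InnerProductSpace ComplexConjugate

noncomputable section

/-- The algebra of polynomial expressions `P(z, z̄)` on `ℂⁿ` with complex coefficients:
`X (Sum.inl i)` stands for the coordinate `zᵢ`, and `X (Sum.inr i)` for its conjugate `z̄ᵢ`. -/
abbrev ConjPoly (n : ℕ) : Type := MvPolynomial (Fin n ⊕ Fin n) ℂ

namespace ConjPoly

variable {n : ℕ}

/-- The value `P(z, z̄)` of a polynomial at a point `z` of `ℂⁿ`. -/
def value (P : ConjPoly n) (z : EuclideanSpace ℂ (Fin n)) : ℂ :=
  MvPolynomial.eval (Sum.elim (fun i => z i) (fun i => conj (z i))) P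

/-- The space of bihomogeneous polynomials of bidegree `(p, q)`:
`P(lz, l̄z̄) = l ^ p * l̄ ^ q * P(z, z̄)` for all `l ∈ ℂ` and `z ∈ ℂⁿ`. -/
def bihomogeneous (n p q : ℕ) : Submodule ℂ (ConjPoly n) where
  carrier := {P | ∀ (l : ℂ) (z : EuclideanSpace ℂ (Fin n)),
    P.value (l • z) = l ^ p * conj l ^ q * P.value z}
  add_mem' := by
    intro P Q hP hQ l z
    have h1 := hP l z
    have h2 := hQ l z
    simp only [value, map_add] at h1 h2 ⊢
    rw [h1, h2, mul_add]
  zero_mem' := by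
    intro l z
    simp [value]
  smul_mem' := by
    intro c P hP l z
    have h1 := hP l z
    simp only [value, MvPolynomial.smul_eval] at h1 ⊢
    rw [h1]
    ring

/-- The Euclidean Laplacian of `ℂⁿ = ℝ²ⁿ` in complex form, `Δ = 4 ∑ⱼ ∂² / ∂zⱼ ∂z̄ⱼ`,
acting on polynomials in the `zⱼ` and `z̄ⱼ`. See `laplacian_value` for the comparison with
the Laplacian of functions. -/
def laplacian (n : ℕ) : ConjPoly n →ₗ[ℂ] ConjPoly n :=
  (4 : ℂ) • ∑ i : Fin n, (MvPolynomial.pderiv (R := ℂ) (Sum.inl i : Fin n ⊕ Fin n)).toLinearMap ∘ₗ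
    (MvPolynomial.pderiv (R := ℂ) (Sum.inr i : Fin n ⊕ Fin n)).toLinearMap

/-- The functions `z ↦ zᵢ` and `z ↦ z̄ᵢ` as real-linear maps. -/
def coordMap : Fin n ⊕ Fin n → (EuclideanSpace ℂ (Fin n) →L[ℝ] ℂ) :=
  Sum.elim (fun i => (EuclideanSpace.proj i : EuclideanSpace ℂ (Fin n) →L[ℂ] ℂ).restrictScalars ℝ)
    (fun i => (Complex.conjCLE : ℂ →L[ℝ] ℂ) ∘L
      (EuclideanSpace.proj i : EuclideanSpace ℂ (Fin n) →L[ℂ] ℂ).restrictScalars ℝ)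

theorem value_eq (P : ConjPoly n) (z : EuclideanSpace ℂ (Fin n)) :
    value P z = MvPolynomial.eval (fun s => coordMap s z) P := by
  unfold value
  congr 2
  funext s
  rcases s with i | i <;> simp [coordMap]

theorem hasFDerivAt_value (P : ConjPoly n) (z : EuclideanSpace ℂ (Fin n)) :
    HasFDerivAt (𝕜 := ℝ) (value P) (∑ s, value (MvPolynomial.pderiv s P) z • coordMap s) z := by
  induction P using MvPolynomial.induction_on with
  | C a =>
    have : (value (MvPolynomial.C a : ConjPoly n)) = fun _ => a := by funext w; simp [value]
    rw [this]
    refine (hasFDerivAt_const (𝕜 := ℝ) a z).congr_fderiv ?_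
    ext v
    simp [value]
  | add P Q hP hQ =>
    have : value (P + Q) = fun w => value P w + value Q w := by funext w; simp [value]
    rw [this]
    refine (hP.fun_add hQ).congr_fderiv ?_
    ext v
    simp only [value, map_add, add_apply, sum_apply, smul_apply, smul_eq_mul, add_mul,
      Finset.sum_add_distrib]
  | mul_X P s hP =>
    have : value (P * MvPolynomial.X s) = fun w => value P w * coordMap s w := by
      funext w; simp [value_eq]
    rw [this]
    refine (hP.fun_mul (coordMap s).hasFDerivAt).congr_fderiv ?_
    ext v
    have h : ∀ t, MvPolynomial.eval (fun s => coordMap s z)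
        (Pi.single (M := fun _ => ConjPoly n) t 1 s) = if t = s then 1 else 0 := by
      intro t
      by_cases ht : t = s
      · subst ht
        simp
      · simp [ht]
    simp only [MvPolynomial.pderiv_mul, value_eq, map_add, map_mul, MvPolynomial.eval_X, add_apply,
      sum_apply, smul_apply, smul_eq_mul, MvPolynomial.pderiv_X, add_mul, Finset.sum_add_distrib, h,
      mul_ite, mul_one, mul_zero, ite_mul, zero_mul, Finset.sum_ite_eq', Finset.mem_univ, if_true,
      Finset.mul_sum]
    rw [add_comm]
    congr 1
    exact Finset.sum_congr rfl fun t _ => by ring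

/-- `laplacian` computes the Laplacian of the polynomial as a function on the real inner product
space underlying `ℂⁿ`. -/
theorem laplacian_value (P : ConjPoly n) (z : EuclideanSpace ℂ (Fin n)) :
    Laplacian.laplacian (value P) z = value (laplacian n P) z := by
  have h1 : fderiv ℝ (value P) =
      fun w => ∑ s, value (MvPolynomial.pderiv s P) w • coordMap s := by
    funext w
    exact (hasFDerivAt_value P w).fderiv
  have h2 : fderiv ℝ (fderiv ℝ (value P)) z =
      ∑ s, (∑ t, value (MvPolynomial.pderiv t (MvPolynomial.pderiv s P)) z •
        coordMap t).smulRight (coordMap s) := by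
    rw [h1]
    refine HasFDerivAt.fderiv ?_
    refine HasFDerivAt.fun_sum fun s _ => ?_
    exact (hasFDerivAt_value _ z).smul_const (coordMap s)
  have key := congrFun (InnerProductSpace.laplacian_eq_iteratedFDeriv_orthonormalBasis (value P)
    (Pi.orthonormalBasis fun _ : Fin n => Complex.orthonormalBasisOneI)) z
  refine key.trans ?_
  simp only [iteratedFDeriv_two_apply, h2, Fintype.sum_sigma, Fin.sum_univ_two,
    Pi.orthonormalBasis_apply, Complex.coe_orthonormalBasisOneI]
  have h3 : value (laplacian n P) z = ∑ i : Fin n,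
      4 * value (MvPolynomial.pderiv (Sum.inl i) (MvPolynomial.pderiv (Sum.inr i) P)) z := by
    simp [laplacian, value, Finset.mul_sum]
  have h4 : ∀ i : Fin n, MvPolynomial.pderiv (Sum.inr i) (MvPolynomial.pderiv (Sum.inl i) P) =
      MvPolynomial.pderiv (Sum.inl i) (MvPolynomial.pderiv (Sum.inr i) P) := by
    intro i
    have h0 : ⁅MvPolynomial.pderiv (R := ℂ) (Sum.inr i : Fin n ⊕ Fin n),
        MvPolynomial.pderiv (R := ℂ) (Sum.inl i : Fin n ⊕ Fin n)⁆ = 0 := by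
      refine MvPolynomial.derivation_ext fun s => ?_
      rw [Derivation.commutator_apply]
      simp only [MvPolynomial.pderiv_X]
      rcases s with s | s <;> by_cases hs : s = i <;> simp [hs]
    have h5 := congrArg (fun D => D P) h0
    simpa [Derivation.commutator_apply, sub_eq_zero] using h5
  rw [h3]
  refine Finset.sum_congr rfl fun i _ => ?_
  simp [coordMap, h4, apply_ite]
  ring_nf
  simp
  ring

/-- The space of solid harmonics of bidegree `(p, q)`: the harmonic bihomogeneous polynomials. -/
def solidHarmonics (n p q : ℕ) : Submodule ℂ (ConjPoly n) :=
  LinearMap.ker (laplacian n) ⊓ bihomogeneous n p q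

/-- `P` is zonal with pole `η`: its restriction to the unit sphere is invariant under the
isotropy group of `η` in `SU(n)`. -/
def IsZonal (η : EuclideanSpace ℂ (Fin n)) (P : ConjPoly n) : Prop :=
  ∀ U ∈ Matrix.specialUnitaryGroup (Fin n) ℂ, Matrix.toEuclideanLin U η = η →
    ∀ ξ : EuclideanSpace ℂ (Fin n), ‖ξ‖ = 1 →
      P.value (Matrix.toEuclideanLin U ξ) = P.value ξ

end ConjPoly

/-- For `(z|η) ≠ 0`, the number
`(z|η)ᵏ * conj (z|η) ʲ * ₂F₁(-k, -j; -α-k-j; 1 / |(ξ|η)|²)`, where `α = n - 2`, `ξ = z / |z|`, and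
`(z|η) = ∑ᵢ zᵢ * conj ηᵢ`, which is `⟪η, z⟫_ℂ` in Mathlib's convention. -/
def zonalExpr {n : ℕ} (k j : ℕ) (η z : EuclideanSpace ℂ (Fin n)) : ℂ :=
  ⟪η, z⟫_ℂ ^ k * conj ⟪η, z⟫_ℂ ^ j *
    ((ordinaryHypergeometric (-(k : ℝ)) (-(j : ℝ)) (-((n : ℝ) - 2) - k - j)
      (1 / ‖⟪η, ‖z‖⁻¹ • z⟫_ℂ‖ ^ 2) : ℝ) : ℂ)

end

/-! For `3 ≤ n` the isotropy group of `η` in `SU(n)` acts transitively on every sphere in the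
orthogonal complement of `η`, so a zonal bihomogeneous polynomial is determined by its values on the
plane spanned by `η` and one unit vector `e ⊥ η`. On a point `w η + s e`, bihomogeneity and
invariance under rotation of `s` leave only the monomials `wᵏ⁻ⁱ w̄ʲ⁻ⁱ (s s̄)ⁱ`. Since `s s̄ = |z|² -
|(z|η)|²`, every such polynomial is a `zonalSum` with `τ = 1` (`exists_eq_zonalSum`).

The Laplacian preserves the shape of these sums and turns harmonicity into a two-term recurrence for
the coefficients (`laplacian_zonalSum`). For `τ = 1` the recurrence determines everything from `a 0`
(`zonalSum_one_eq_zero`), so zonal harmonics are unique up to a scalar. For `τ = 0`, the expansion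
in powers of `|z|²`, it is the recurrence of the hypergeometric coefficients (`zonalCoeff_succ`),
which gives existence. The parameter `τ` lets one computation serve both expansions. -/

namespace ConjPoly

open MvPolynomial

variable {n : ℕ}

/-! ### The basic forms and their Laplacians -/

/-- The polynomial `(z|η)`. -/
noncomputable def poleForm (η : EuclideanSpace ℂ (Fin n)) : ConjPoly n :=
  ∑ i, C (conj (η i)) * X (Sum.inl i)

/-- The polynomial conjugate to `(z|η)`. -/
noncomputable def conjPoleForm (η : EuclideanSpace ℂ (Fin n)) : ConjPoly n :=
  ∑ i, C (η i) * X (Sum.inr i)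

/-- The polynomial `|z|²`. -/
noncomputable def normSqForm (n : ℕ) : ConjPoly n :=
  ∑ i, X (Sum.inl i) * X (Sum.inr i)

/-- The quadratic form `|z|² - τ |(z|η)|²`. -/
noncomputable def quadForm (τ : ℂ) (η : EuclideanSpace ℂ (Fin n)) : ConjPoly n :=
  normSqForm n - C τ * (poleForm η * conjPoleForm η)

theorem value_poleForm (η z : EuclideanSpace ℂ (Fin n)) : value (poleForm η) z = ⟪η, z⟫_ℂ := by
  simp [value, poleForm, PiLp.inner_apply, mul_comm]

theorem value_conjPoleForm (η z : EuclideanSpace ℂ (Fin n)) :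
    value (conjPoleForm η) z = conj ⟪η, z⟫_ℂ := by
  simp [value, conjPoleForm, PiLp.inner_apply, mul_comm]

theorem value_normSqForm (z : EuclideanSpace ℂ (Fin n)) :
    value (normSqForm n) z = (‖z‖ : ℂ) ^ 2 := by
  rw [← Complex.ofReal_pow, EuclideanSpace.norm_sq_eq]
  simp [value, normSqForm, Complex.mul_conj, Complex.normSq_eq_norm_sq]

theorem value_quadForm (τ : ℂ) (η z : EuclideanSpace ℂ (Fin n)) :
    value (quadForm τ η) z = (‖z‖ : ℂ) ^ 2 - τ * (⟪η, z⟫_ℂ * conj ⟪η, z⟫_ℂ) := by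
  rw [← value_normSqForm, ← value_conjPoleForm, ← value_poleForm]
  simp [value, quadForm]

theorem pderiv_inl_poleForm (η : EuclideanSpace ℂ (Fin n)) (l : Fin n) :
    pderiv (Sum.inl l) (poleForm η) = C (conj (η l)) := by
  simp [poleForm, pderiv_X, Pi.single_apply]

theorem pderiv_inr_poleForm (η : EuclideanSpace ℂ (Fin n)) (l : Fin n) :
    pderiv (Sum.inr l) (poleForm η) = 0 := by
  simp [poleForm, pderiv_X]

theorem pderiv_inl_conjPoleForm (η : EuclideanSpace ℂ (Fin n)) (l : Fin n) :
    pderiv (Sum.inl l) (conjPoleForm η) = 0 := by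
  simp [conjPoleForm, pderiv_X]

theorem pderiv_inr_conjPoleForm (η : EuclideanSpace ℂ (Fin n)) (l : Fin n) :
    pderiv (Sum.inr l) (conjPoleForm η) = C (η l) := by
  simp [conjPoleForm, pderiv_X, Pi.single_apply]

theorem pderiv_inl_normSqForm (l : Fin n) :
    pderiv (Sum.inl l) (normSqForm n) = X (Sum.inr l) := by
  simp [normSqForm, pderiv_X, Pi.single_apply]

theorem pderiv_inr_normSqForm (l : Fin n) :
    pderiv (Sum.inr l) (normSqForm n) = X (Sum.inl l) := by
  simp [normSqForm, pderiv_X, Pi.single_apply]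

theorem pderiv_inl_quadForm (τ : ℂ) (η : EuclideanSpace ℂ (Fin n)) (l : Fin n) :
    pderiv (Sum.inl l) (quadForm τ η) =
      X (Sum.inr l) - C τ * (C (conj (η l)) * conjPoleForm η) := by
  rw [quadForm, map_sub, pderiv_C_mul, pderiv_mul, pderiv_inl_normSqForm, pderiv_inl_poleForm,
    pderiv_inl_conjPoleForm]
  ring

theorem pderiv_inr_quadForm (τ : ℂ) (η : EuclideanSpace ℂ (Fin n)) (l : Fin n) :
    pderiv (Sum.inr l) (quadForm τ η) =
      X (Sum.inl l) - C τ * (C (η l) * poleForm η) := by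
  rw [quadForm, map_sub, pderiv_C_mul, pderiv_mul, pderiv_inr_normSqForm, pderiv_inr_poleForm,
    pderiv_inr_conjPoleForm]
  ring

theorem sum_C_mul_C_conj {η : EuclideanSpace ℂ (Fin n)} (hη : ‖η‖ = 1) :
    ∑ l, (C (η l) * C (conj (η l)) : ConjPoly n) = 1 := by
  have h : ∑ l, η l * conj (η l) = 1 := by
    have := EuclideanSpace.norm_sq_eq η
    rw [hη, one_pow] at this
    simp only [Complex.mul_conj, Complex.normSq_eq_norm_sq]
    exact_mod_cast this.symm
  rw [← C_1, ← h, map_sum]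
  simp

theorem pderiv_pderiv_quadForm_mul (τ : ℂ) (η : EuclideanSpace ℂ (Fin n)) (i a b : ℕ) (l : Fin n) :
    pderiv (Sum.inl l) (pderiv (Sum.inr l)
        (quadForm τ η ^ i * (poleForm η ^ a * conjPoleForm η ^ b))) =
      (i * (i - 1 : ℕ) : ConjPoly n) * quadForm τ η ^ (i - 2) * poleForm η ^ a *
          conjPoleForm η ^ b *
        (X (Sum.inl l) * X (Sum.inr l) - C τ * poleForm η * (C (η l) * X (Sum.inr l)) -
          C τ * conjPoleForm η * (C (conj (η l)) * X (Sum.inl l)) +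
          C τ * C τ * poleForm η * conjPoleForm η * (C (η l) * C (conj (η l)))) +
      (i : ConjPoly n) * quadForm τ η ^ (i - 1) * poleForm η ^ a * conjPoleForm η ^ b *
        (1 - C τ * (C (η l) * C (conj (η l)))) +
      (i * a : ConjPoly n) * quadForm τ η ^ (i - 1) * poleForm η ^ (a - 1) * conjPoleForm η ^ b *
        (C (conj (η l)) * X (Sum.inl l) - C τ * poleForm η * (C (η l) * C (conj (η l)))) +
      (i * b : ConjPoly n) * quadForm τ η ^ (i - 1) * poleForm η ^ a * conjPoleForm η ^ (b - 1) *
        (C (η l) * X (Sum.inr l) - C τ * conjPoleForm η * (C (η l) * C (conj (η l)))) +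
      (a * b : ConjPoly n) * quadForm τ η ^ i * poleForm η ^ (a - 1) * conjPoleForm η ^ (b - 1) *
        (C (η l) * C (conj (η l))) := by
  have e : ∀ m : ℕ, (m : ConjPoly n) = C (m : ℂ) := fun m => by simp
  simp only [e, pderiv_mul, pderiv_pow, pderiv_C, map_add, map_sub, pderiv_inr_quadForm,
    pderiv_inl_quadForm, pderiv_inr_poleForm, pderiv_inl_poleForm, pderiv_inr_conjPoleForm,
    pderiv_inl_conjPoleForm, pderiv_X_self, mul_zero, zero_mul, zero_add, add_zero, Nat.sub_sub]
  ring

/-- Writing `q` for the quadratic form, `∑ ∂q/∂zₗ · ∂q/∂z̄ₗ = |z|² - (2τ - τ²)|(z|η)|²`. This equals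
`q` again exactly because `τ² = τ`, so the second-order term lowers the exponent of `q` by one and
no new form appears. -/
theorem laplacian_quadForm_mul {τ : ℂ} (hτ : τ * τ = τ) {η : EuclideanSpace ℂ (Fin n)}
    (hη : ‖η‖ = 1) (i a b : ℕ) :
    laplacian n (quadForm τ η ^ i * (poleForm η ^ a * conjPoleForm η ^ b)) =
      C (4 * (i * (n - τ + i - 1 + (1 - τ) * (a + b))) : ℂ) *
          (quadForm τ η ^ (i - 1) * (poleForm η ^ a * conjPoleForm η ^ b)) +
      C (4 * (a * b) : ℂ) *
          (quadForm τ η ^ i * (poleForm η ^ (a - 1) * conjPoleForm η ^ (b - 1))) := by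
  have h1 := sum_C_mul_C_conj hη
  have hτ' : (C τ * C τ : ConjPoly n) = C τ := by rw [← C_mul, hτ]
  have e : ∀ m : ℕ, (C (m : ℂ) : ConjPoly n) = m := fun m => by simp
  have h4 : (C 4 : ConjPoly n) = 4 := by simpa using e 4
  have hD : normSqForm n = quadForm τ η + C τ * (poleForm η * conjPoleForm η) := by
    simp [quadForm]
  have hL : ∀ P, laplacian n P = 4 * ∑ l, pderiv (Sum.inl l) (pderiv (Sum.inr l) P) := by
    intro P
    rw [← h4, ← MvPolynomial.smul_eq_C_mul]
    simp [laplacian]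
  simp only [hL, pderiv_pderiv_quadForm_mul, Finset.sum_add_distrib, Finset.sum_sub_distrib,
    ← Finset.mul_sum, h1]
  rw [← normSqForm, ← poleForm, ← conjPoleForm, hD]
  simp only [Finset.sum_const, Finset.card_univ, Fintype.card_fin, nsmul_eq_mul, mul_one, hτ',
    C_mul, C_add, C_sub, e, h4, C_1]
  -- The exponents `i - 2`, `i - 1`, `a - 1`, `b - 1` are truncated; wherever truncation occurs the
  -- coefficient in front is zero.
  rcases i with _ | _ | i <;> rcases a with _ | a <;> rcases b with _ | b <;>
    simp <;> ring

/-! ### Polynomials as functions, and torus weights -/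

/-- The substitution `z = x + iy`, `z̄ = x - iy` is an invertible linear change of variables. After
it the polynomial vanishes at all real points, hence identically. -/
theorem eq_zero_of_value_eq_zero {P : ConjPoly n} (h : ∀ z, value P z = 0) : P = 0 := by
  let Q : ConjPoly n := bind₁ (Sum.elim (fun i => X (Sum.inl i) + C Complex.I * X (Sum.inr i))
    (fun i => X (Sum.inl i) - C Complex.I * X (Sum.inr i))) P
  have hQ : ∀ x, eval x Q = eval (Sum.elim (fun i => x (Sum.inl i) + Complex.I * x (Sum.inr i))
      (fun i => x (Sum.inl i) - Complex.I * x (Sum.inr i))) P := by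
    intro x
    change eval₂Hom (RingHom.id ℂ) x (bind₁ _ P) = _
    rw [eval₂Hom_bind₁]
    change eval _ P = _
    congr 2
    funext s
    rcases s with i | i <;> simp
  have h0 : Q = 0 := by
    refine funext_set (fun _ => Set.range ((↑) : ℝ → ℂ))
      (fun _ => Set.infinite_range_of_injective Complex.ofReal_injective) fun x hx => ?_
    choose y hy using fun s => hx s (Set.mem_univ s)
    rw [hQ, map_zero, ← h (WithLp.toLp 2 fun i => y (Sum.inl i) + Complex.I * y (Sum.inr i)), value]
    congr 2
    funext s
    rcases s with i | i <;> simp [← hy, sub_eq_add_neg]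
  refine MvPolynomial.funext fun x => ?_
  -- The inverse substitution, at an arbitrary complex point.
  have := hQ (Sum.elim (fun i => (x (Sum.inl i) + x (Sum.inr i)) / 2)
    (fun i => (x (Sum.inl i) - x (Sum.inr i)) / (2 * Complex.I)))
  rw [h0, map_zero] at this
  rw [map_zero, this]
  congr 2
  funext s
  rcases s with i | i <;> simp <;> field_simp [Complex.I_ne_zero] <;> ring

theorem value_injective : Function.Injective (value (n := n)) := by
  intro P Q h
  refine sub_eq_zero.mp (eq_zero_of_value_eq_zero fun z => ?_)
  have := congrFun h z
  simpa [value, sub_eq_zero] using this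

/-- The monomials of a polynomial that is semi-invariant under a diagonal change of variables
have the corresponding weight. -/
theorem weight_eq_of_coeff_ne_zero {P : ConjPoly n} (l : Fin n → ℂ) (μ : ℂ)
    (h : ∀ z : EuclideanSpace ℂ (Fin n),
      value P (WithLp.toLp 2 fun i => l i * z i) = μ * value P z)
    {m : Fin n ⊕ Fin n →₀ ℕ} (hm : coeff m P ≠ 0) :
    ∏ i, l i ^ m (Sum.inl i) * conj (l i) ^ m (Sum.inr i) = μ := by
  let w : Fin n ⊕ Fin n → ℂ := Sum.elim l fun i => conj (l i)
  have hc : ∀ P : ConjPoly n, coeff m (bind₁ (fun s => C (w s) * X s) P) =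
      (∏ s, w s ^ m s) * coeff m P := by
    intro P
    induction P using MvPolynomial.induction_on' with
    | monomial u a =>
      rw [bind₁_monomial]
      simp only [mul_pow, Finset.prod_mul_distrib, ← C_pow]
      rw [← map_prod C, ← mul_assoc, ← C_mul, coeff_C_mul,
        show ∏ s ∈ u.support, (X s : ConjPoly n) ^ u s = monomial u 1 by
          rw [monomial_eq]; simp [Finsupp.prod], coeff_monomial, coeff_monomial]
      split_ifs with hu
      · subst hu
        rw [Finset.prod_subset (Finset.subset_univ u.support)]
        · ring
        · intro s _ hs
          simp [Finsupp.notMem_support_iff.mp hs]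
      · simp
    | add P Q hP hQ => simp [hP, hQ, mul_add]
  have key : bind₁ (fun s => C (w s) * X s) P = C μ * P := by
    refine value_injective (funext fun z => ?_)
    have : value (C μ * P) z = μ * value P z := by simp [value]
    rw [this, ← h z, value]
    change eval₂Hom (RingHom.id ℂ) _ (bind₁ _ P) = _
    rw [eval₂Hom_bind₁]
    change eval _ P = eval _ P
    congr 2
    funext s
    rcases s with i | i <;> simp [w]
  have := hc P
  rw [key, coeff_C_mul] at this
  have := mul_right_cancel₀ hm this
  rw [this, Fintype.prod_sum_type, Finset.prod_mul_distrib]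
  simp [w]

/-- The single value `l = exp(i)` suffices: it is not a root of unity, because `π` is irrational. -/
theorem eq_of_forall_pow_mul_conj_pow {a b c d : ℕ}
    (h : ∀ l : ℂ, ‖l‖ = 1 → l ^ a * conj l ^ b = l ^ c * conj l ^ d) : a + d = c + b := by
  have hc : conj (Complex.exp Complex.I) = Complex.exp (-Complex.I) := by
    rw [← Complex.exp_conj, Complex.conj_I]
  have h1 := h (Complex.exp Complex.I) (by simpa using Complex.norm_exp_ofReal_mul_I 1)
  rw [hc, ← Complex.exp_nat_mul, ← Complex.exp_nat_mul, ← Complex.exp_nat_mul,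
    ← Complex.exp_nat_mul, ← Complex.exp_add, ← Complex.exp_add,
    Complex.exp_eq_exp_iff_exists_int] at h1
  obtain ⟨N, hN⟩ := h1
  have h2 : ((a : ℂ) - b - c + d) * Complex.I = (N * (2 * Real.pi)) * Complex.I := by
    linear_combination hN
  have h3 := mul_right_cancel₀ Complex.I_ne_zero h2
  have h4 : (((a : ℤ) - b - c + d : ℤ) : ℝ) = (N * 2 : ℤ) * Real.pi := by
    push_cast
    have h3' : (((a : ℝ) - b - c + d : ℝ) : ℂ) = ((N * 2 * Real.pi : ℝ) : ℂ) := by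
      push_cast; linear_combination h3
    have h3'' := Complex.ofReal_injective h3'
    linarith
  have hN0 : (N * 2 : ℤ) = 0 := by
    by_contra hne
    refine (irrational_pi.intCast_mul hne) ⟨(((a : ℤ) - b - c + d : ℤ) : ℚ), ?_⟩
    rw [← h4]
    push_cast
    ring
  rw [hN0] at h4
  have h5 : (a : ℤ) - b - c + d = 0 := by
    rw [Int.cast_zero, zero_mul] at h4
    exact_mod_cast h4
  omega

/-! ### Transitivity of the isotropy group -/

theorem exists_orthonormal_pair_extension (hn : 3 ≤ n) {x y : EuclideanSpace ℂ (Fin n)}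
    (hx : ‖x‖ = 1) (hy : ‖y‖ = 1) (hxy : ⟪x, y⟫_ℂ = 0) :
    ∃ b : OrthonormalBasis (Fin n) ℂ (EuclideanSpace ℂ (Fin n)),
      b ⟨0, by omega⟩ = x ∧ b ⟨1, by omega⟩ = y := by
  let v : Fin n → EuclideanSpace ℂ (Fin n) := fun i => if i.1 = 0 then x else y
  have hyx : ⟪y, x⟫_ℂ = 0 := by rw [← inner_conj_symm, hxy, map_zero]
  obtain ⟨b, hb⟩ := Orthonormal.exists_orthonormalBasis_extension_of_card_eq (𝕜 := ℂ)
    (ι := Fin n) (E := EuclideanSpace ℂ (Fin n)) (by simp) (v := v)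
    (s := {⟨0, by omega⟩, ⟨1, by omega⟩}) (by
      constructor
      · rintro ⟨i, hi⟩
        by_cases h : i.1 = 0 <;> simp [v, h, hx, hy]
      · rintro ⟨i, hi⟩ ⟨j, hj⟩ hij
        simp only [Set.mem_insert_iff, Set.mem_singleton_iff] at hi hj
        rcases hi with rfl | rfl <;> rcases hj with rfl | rfl <;> simp [v, hxy, hyx] at hij ⊢)
  exact ⟨b, by simpa [v] using hb ⟨0, by omega⟩ (by simp),
    by simpa [v] using hb ⟨1, by omega⟩ (by simp)⟩

theorem exists_mem_specialUnitaryGroup_col (hn : 3 ≤ n) {x y : EuclideanSpace ℂ (Fin n)}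
    (hx : ‖x‖ = 1) (hy : ‖y‖ = 1) (hxy : ⟪x, y⟫_ℂ = 0) :
    ∃ A ∈ Matrix.specialUnitaryGroup (Fin n) ℂ,
      (∀ i, A i ⟨0, by omega⟩ = x i) ∧ ∀ i, A i ⟨1, by omega⟩ = y i := by
  obtain ⟨b, hb0, hb1⟩ := exists_orthonormal_pair_extension hn hx hy hxy
  let B : Matrix (Fin n) (Fin n) ℂ := Matrix.of fun i j => b j i
  have hB : B ∈ Matrix.unitaryGroup (Fin n) ℂ := by
    rw [Matrix.mem_unitaryGroup_iff']
    ext i j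
    have := b.inner_eq_ite i j
    rw [PiLp.inner_apply] at this
    simp only [RCLike.inner_apply] at this
    rw [Matrix.one_apply, ← this, Matrix.mul_apply]
    exact Finset.sum_congr rfl fun l _ => by simp [B, Matrix.star_apply, mul_comm]
  have hdet : B.det * conj B.det = 1 := (Matrix.det_of_mem_unitary hB).2
  -- Rescaling the third column brings the determinant to `1` without touching the two prescribed
  -- columns; this is where `3 ≤ n` is needed.
  let d : Fin n → ℂ := Function.update 1 ⟨2, by omega⟩ (conj B.det)
  have hd : Matrix.diagonal d ∈ Matrix.unitaryGroup (Fin n) ℂ := by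
    rw [Matrix.mem_unitaryGroup_iff]
    rw [Matrix.star_eq_conjTranspose, Matrix.diagonal_conjTranspose, Matrix.diagonal_mul_diagonal,
      ← Matrix.diagonal_one]
    congr 1
    funext i
    by_cases hi : i = ⟨2, by omega⟩
    · subst hi
      simpa [d, mul_comm] using hdet
    · simp [d, hi]
  refine ⟨B * Matrix.diagonal d, ?_, ?_, ?_⟩
  · rw [Matrix.mem_specialUnitaryGroup_iff]
    refine ⟨mul_mem hB hd, ?_⟩
    rw [Matrix.det_mul, Matrix.det_diagonal, Finset.prod_update_of_mem (Finset.mem_univ _)]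
    simpa using hdet
  · intro i
    simp [Matrix.mul_diagonal, d, B, hb0]
  · intro i
    simp [Matrix.mul_diagonal, d, B, hb1]

theorem exists_mem_specialUnitaryGroup_map (hn : 3 ≤ n) {η x y : EuclideanSpace ℂ (Fin n)}
    (hη : ‖η‖ = 1) (hx : ‖x‖ = 1) (hy : ‖y‖ = 1) (hηx : ⟪η, x⟫_ℂ = 0) (hηy : ⟪η, y⟫_ℂ = 0) :
    ∃ U ∈ Matrix.specialUnitaryGroup (Fin n) ℂ,
      Matrix.toEuclideanLin U η = η ∧ Matrix.toEuclideanLin U x = y := by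
  obtain ⟨A, hA, hA0, hA1⟩ := exists_mem_specialUnitaryGroup_col hn hη hx hηx
  obtain ⟨B, hB, hB0, hB1⟩ := exists_mem_specialUnitaryGroup_col hn hη hy hηy
  have e : ∀ (M : Matrix (Fin n) (Fin n) ℂ) (l : Fin n) (u : EuclideanSpace ℂ (Fin n)),
      (∀ i, M i l = u i) → u.ofLp = M.mulVec (Pi.single l 1) := by
    intro M l u h
    funext i
    simp [h]
  have hAA : star A * A = 1 := Matrix.mem_unitaryGroup_iff'.mp
    (Matrix.mem_specialUnitaryGroup_iff.mp hA).1
  -- `B A*` carries each column of `A` to the corresponding column of `B`.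
  refine ⟨B * star A, mul_mem hB ?_, ?_, ?_⟩
  · exact (star (⟨A, hA⟩ : Matrix.specialUnitaryGroup (Fin n) ℂ)).2
  · apply (WithLp.ofLp_injective 2)
    rw [Matrix.ofLp_toLpLin, Matrix.toLin'_apply, e A _ η hA0, Matrix.mulVec_mulVec, mul_assoc, hAA, mul_one,
      ← e B _ η hB0, e A _ η hA0]
  · apply (WithLp.ofLp_injective 2)
    rw [Matrix.ofLp_toLpLin, Matrix.toLin'_apply, e A _ x hA1, Matrix.mulVec_mulVec, mul_assoc, hAA, mul_one,
      ← e B _ y hB1]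

theorem exists_norm_eq_one_inner_eq_zero (hn : 2 ≤ n) (η : EuclideanSpace ℂ (Fin n)) :
    ∃ e : EuclideanSpace ℂ (Fin n), ‖e‖ = 1 ∧ ⟪η, e⟫_ℂ = 0 := by
  have h : (ℂ ∙ η)ᗮ ≠ ⊥ := by
    intro h
    rw [Submodule.orthogonal_eq_bot_iff] at h
    have h1 := finrank_span_le_card (R := ℂ) ({η} : Set (EuclideanSpace ℂ (Fin n)))
    rw [h, finrank_top, finrank_euclideanSpace_fin, Set.toFinset_singleton,
      Finset.card_singleton] at h1
    omega
  obtain ⟨v, hv, hv0⟩ := Submodule.exists_mem_ne_zero_of_ne_bot h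
  rw [Submodule.mem_orthogonal_singleton_iff_inner_right] at hv
  exact ⟨((‖v‖⁻¹ : ℝ) : ℂ) • v, by simp [norm_smul, hv0], by rw [inner_smul_right, hv, mul_zero]⟩

/-- Every vector is a multiple of a unit vector, so bihomogeneity extends the invariance from the
sphere to the whole space. -/
theorem value_toEuclideanLin_eq {k j : ℕ} {η : EuclideanSpace ℂ (Fin n)} {P : ConjPoly n}
    (hP : P ∈ bihomogeneous n k j) (hz : IsZonal η P) {U : Matrix (Fin n) (Fin n) ℂ}
    (hU : U ∈ Matrix.specialUnitaryGroup (Fin n) ℂ) (hη : Matrix.toEuclideanLin U η = η)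
    (z : EuclideanSpace ℂ (Fin n)) :
    value P (Matrix.toEuclideanLin U z) = value P z := by
  rcases eq_or_ne z 0 with rfl | hz0
  · simp
  have h1 : z = (‖z‖ : ℂ) • ((‖z‖⁻¹ : ℝ) : ℂ) • z := by
    rw [smul_smul, ← Complex.ofReal_mul, mul_inv_cancel₀ (by simpa using hz0)]
    simp
  rw [h1, map_smul, hP, hP, hz U hU hη]
  rw [norm_smul]
  simp [hz0]

/-- A zonal bihomogeneous polynomial depends only on `(z|η)` and `|z|`. -/
theorem value_eq_of_inner_eq_of_norm_eq (hn : 3 ≤ n) {k j : ℕ} {η : EuclideanSpace ℂ (Fin n)}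
    (hη : ‖η‖ = 1) {P : ConjPoly n} (hP : P ∈ bihomogeneous n k j) (hz : IsZonal η P)
    (w : ℂ) {x y : EuclideanSpace ℂ (Fin n)} (hx : ⟪η, x⟫_ℂ = 0) (hy : ⟪η, y⟫_ℂ = 0)
    (hxy : ‖x‖ = ‖y‖) : value P (w • η + x) = value P (w • η + y) := by
  rcases eq_or_ne x 0 with rfl | hx0
  · have : y = 0 := by simpa using hxy.symm
    rw [this]
  have hy0 : y ≠ 0 := by rw [← norm_ne_zero_iff, ← hxy]; simpa using hx0
  have hu : ∀ v : EuclideanSpace ℂ (Fin n), v ≠ 0 → v = (‖v‖ : ℂ) • ((‖v‖⁻¹ : ℝ) : ℂ) • v := by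
    intro v hv
    rw [smul_smul, ← Complex.ofReal_mul, mul_inv_cancel₀ (by simpa using hv)]
    simp
  obtain ⟨U, hU, hUη, hUx⟩ := exists_mem_specialUnitaryGroup_map hn hη
    (x := ((‖x‖⁻¹ : ℝ) : ℂ) • x) (y := ((‖y‖⁻¹ : ℝ) : ℂ) • y)
    (by simp [norm_smul, hx0]) (by simp [norm_smul, hy0])
    (by rw [inner_smul_right, hx, mul_zero]) (by rw [inner_smul_right, hy, mul_zero])
  rw [← value_toEuclideanLin_eq hP hz hU hUη (w • η + x)]
  congr 1
  rw [map_add, map_smul, hUη, hu x hx0, map_smul, hUx, hxy, ← hu y hy0]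

/-! ### Zonal sums and the recurrence for harmonicity -/

/-- The polynomial `∑ aᵢ (|z|² - τ |(z|η)|²)ⁱ (z|η)ᵏ⁻ⁱ conj (z|η)ʲ⁻ⁱ`. -/
noncomputable def zonalSum (τ : ℂ) (η : EuclideanSpace ℂ (Fin n)) (k j : ℕ) (a : ℕ → ℂ) :
    ConjPoly n :=
  ∑ i ∈ Finset.range (min k j + 1),
    C (a i) * (quadForm τ η ^ i * (poleForm η ^ (k - i) * conjPoleForm η ^ (j - i)))

theorem value_zonalSum (τ : ℂ) (η : EuclideanSpace ℂ (Fin n)) (k j : ℕ) (a : ℕ → ℂ)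
    (z : EuclideanSpace ℂ (Fin n)) :
    value (zonalSum τ η k j a) z = ∑ i ∈ Finset.range (min k j + 1),
      a i * (((‖z‖ : ℂ) ^ 2 - τ * (⟪η, z⟫_ℂ * conj ⟪η, z⟫_ℂ)) ^ i *
        (⟪η, z⟫_ℂ ^ (k - i) * conj ⟪η, z⟫_ℂ ^ (j - i))) := by
  rw [← value_quadForm, ← value_conjPoleForm, ← value_poleForm]
  simp [value, zonalSum]

theorem zonalSum_sub_smul (τ : ℂ) (η : EuclideanSpace ℂ (Fin n)) (k j : ℕ) (a b : ℕ → ℂ) (c : ℂ) :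
    zonalSum τ η k j (fun i => a i - c * b i) = zonalSum τ η k j a - c • zonalSum τ η k j b := by
  simp only [zonalSum, Finset.smul_sum, ← Finset.sum_sub_distrib, MvPolynomial.smul_eq_C_mul,
    C_sub, C_mul]
  exact Finset.sum_congr rfl fun i _ => by ring

theorem zonalSum_mem_bihomogeneous (τ : ℂ) (η : EuclideanSpace ℂ (Fin n)) (k j : ℕ) (a : ℕ → ℂ) :
    zonalSum τ η k j a ∈ bihomogeneous n k j := by
  intro l z
  rw [value_zonalSum, value_zonalSum, Finset.mul_sum]
  refine Finset.sum_congr rfl fun i hi => ?_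
  have hi' : i ≤ min k j := by simpa [Nat.lt_succ_iff] using hi
  have hk : k = i + (k - i) := by omega
  have hj : j = i + (j - i) := by omega
  have hl : ((‖l‖ : ℝ) : ℂ) ^ 2 = l * conj l := (Complex.mul_conj' l).symm
  rw [inner_smul_right, norm_smul, Complex.ofReal_mul, map_mul, mul_pow _ _ 2, hl]
  conv_rhs => rw [show l ^ k * conj l ^ j = (l * conj l) ^ i * (l ^ (k - i) * conj l ^ (j - i)) by
    rw [mul_pow, mul_mul_mul_comm, ← pow_add, ← pow_add, ← hk, ← hj]]
  rw [show l * conj l * (‖z‖ : ℂ) ^ 2 - τ * (l * ⟪η, z⟫_ℂ * (conj l * conj ⟪η, z⟫_ℂ)) =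
    (l * conj l) * ((‖z‖ : ℂ) ^ 2 - τ * (⟪η, z⟫_ℂ * conj ⟪η, z⟫_ℂ)) by ring]
  simp only [mul_pow]
  ring

theorem isZonal_zonalSum (τ : ℂ) (η : EuclideanSpace ℂ (Fin n)) (k j : ℕ) (a : ℕ → ℂ) :
    IsZonal η (zonalSum τ η k j a) := by
  intro U hU hη ξ _
  have hUU : U.conjTranspose * U = 1 := Matrix.mem_unitaryGroup_iff'.mp
    (Matrix.mem_specialUnitaryGroup_iff.mp hU).1
  have h : ∀ x y, ⟪Matrix.toEuclideanLin U x, Matrix.toEuclideanLin U y⟫_ℂ = ⟪x, y⟫_ℂ := by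
    intro x y
    rw [← LinearMap.adjoint_inner_right, ← Matrix.toEuclideanLin_conjTranspose_eq_adjoint]
    congr 1
    apply WithLp.ofLp_injective 2
    simp [Matrix.ofLp_toLpLin, Matrix.toLin'_apply, hUU]
  have h1 : ⟪η, Matrix.toEuclideanLin U ξ⟫_ℂ = ⟪η, ξ⟫_ℂ := by
    conv_lhs => rw [← hη]
    exact h η ξ
  have h2 : ‖Matrix.toEuclideanLin U ξ‖ = ‖ξ‖ := by
    rw [norm_eq_sqrt_re_inner (𝕜 := ℂ), h, ← norm_eq_sqrt_re_inner]
  rw [value_zonalSum, value_zonalSum, h1, h2]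

theorem laplacian_zonalSum {τ : ℂ} (hτ : τ * τ = τ) {η : EuclideanSpace ℂ (Fin n)}
    (hη : ‖η‖ = 1) (k j : ℕ) (a : ℕ → ℂ) :
    laplacian n (zonalSum τ η k j a) = ∑ i ∈ Finset.range (min k j),
      C (4 * (a (i + 1) * ((i + 1) * (n - τ + i + (1 - τ) * (k + j - 2 * (i + 1)))) +
          a i * ((k - i) * (j - i))) : ℂ) *
        (quadForm τ η ^ i * (poleForm η ^ (k - (i + 1)) * conjPoleForm η ^ (j - (i + 1)))) := by
  rw [zonalSum, map_sum]
  simp only [← MvPolynomial.smul_eq_C_mul, map_smul, laplacian_quadForm_mul hτ hη, smul_add,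
    smul_smul]
  rw [Finset.sum_add_distrib, Finset.sum_range_succ', Finset.sum_range_succ _ (min k j)]
  -- Both boundary terms drop out: at `i = 0` there is no power of the quadratic form to lower, and
  -- at `i = min k j` one of `k - i`, `j - i` is zero.
  have h0 : (((k - min k j : ℕ) : ℂ) * ((j - min k j : ℕ) : ℂ)) = 0 := by
    rcases le_total k j with h | h <;> simp [h]
  simp only [h0, Nat.cast_zero, zero_mul, mul_zero, zero_smul, add_zero]
  rw [← Finset.sum_add_distrib]
  refine Finset.sum_congr rfl fun i hi => ?_
  have hi' : i < min k j := Finset.mem_range.mp hi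
  rw [Nat.cast_sub (by omega), Nat.cast_sub (by omega), Nat.cast_sub (by omega),
    Nat.cast_sub (by omega), Nat.add_sub_cancel, Nat.sub_sub, Nat.sub_sub, ← add_smul]
  congr 1
  push_cast
  ring

/-- Here `z` and `z̄` are independent variables: `e` enters the first with factor `s` and the second
with factor `1`. The quadratic form thus takes arbitrary complex values while both pole forms stay
`1`, which isolates the coefficients of a zonal sum. -/
theorem exists_eval_quadForm_eq {η e : EuclideanSpace ℂ (Fin n)} (hη : ‖η‖ = 1) (he : ‖e‖ = 1)
    (hηe : ⟪η, e⟫_ℂ = 0) (τ s : ℂ) :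
    ∃ x, eval x (poleForm η) = 1 ∧ eval x (conjPoleForm η) = 1 ∧
      eval x (quadForm τ η) = 1 + s - τ := by
  let x : Fin n ⊕ Fin n → ℂ :=
    Sum.elim (fun i => η i + s * e i) (fun i => conj (η i) + conj (e i))
  have hn : ∀ v : EuclideanSpace ℂ (Fin n), ‖v‖ = 1 → ∑ i, v i * conj (v i) = 1 := by
    intro v hv
    have := inner_self_eq_norm_sq_to_K (𝕜 := ℂ) v
    rw [hv, PiLp.inner_apply] at this
    simpa only [RCLike.inner_apply, map_one, one_pow] using this
  have h1 : ∑ i, e i * conj (η i) = 0 := by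
    simpa [PiLp.inner_apply] using hηe
  have h2 : ∑ i, η i * conj (e i) = 0 := by
    have := congrArg conj h1
    simpa [mul_comm] using this
  have hW : eval x (poleForm η) = 1 := by
    calc eval x (poleForm η) = ∑ i, (η i * conj (η i) + s * (e i * conj (η i))) := by
          simp only [poleForm, map_sum, map_mul, eval_C, eval_X, x, Sum.elim_inl]
          exact Finset.sum_congr rfl fun i _ => by ring
      _ = 1 := by rw [Finset.sum_add_distrib, ← Finset.mul_sum, hn η hη, h1]; ring
  have hV : eval x (conjPoleForm η) = 1 := by
    calc eval x (conjPoleForm η) = ∑ i, (η i * conj (η i) + η i * conj (e i)) := by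
          simp only [conjPoleForm, map_sum, map_mul, eval_C, eval_X, x, Sum.elim_inr]
          exact Finset.sum_congr rfl fun i _ => by ring
      _ = 1 := by rw [Finset.sum_add_distrib, hn η hη, h2, add_zero]
  refine ⟨x, hW, hV, ?_⟩
  have hR : eval x (normSqForm n) = 1 + s := by
    calc eval x (normSqForm n) = ∑ i, (η i * conj (η i) + s * (e i * conj (η i)) +
            η i * conj (e i) + s * (e i * conj (e i))) := by
          simp only [normSqForm, map_sum, map_mul, eval_X, x, Sum.elim_inr, Sum.elim_inl]
          exact Finset.sum_congr rfl fun i _ => by ring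
      _ = 1 + s := by
          rw [Finset.sum_add_distrib, Finset.sum_add_distrib, Finset.sum_add_distrib,
            ← Finset.mul_sum, ← Finset.mul_sum, hn η hη, hn e he, h1, h2]
          ring
  rw [quadForm, map_sub, map_mul, map_mul, hW, hV, hR, eval_C]
  ring

theorem coeff_eq_zero_of_sum_mul_pow_eq_zero {m : ℕ} {d : ℕ → ℂ}
    (h : ∀ u : ℂ, ∑ i ∈ Finset.range m, d i * u ^ i = 0) {i : ℕ} (hi : i < m) : d i = 0 := by
  have hp : (∑ i ∈ Finset.range m, Polynomial.C (d i) * Polynomial.X ^ i : Polynomial ℂ) = 0 := by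
    refine Polynomial.funext fun u => ?_
    simpa [Polynomial.eval_finsetSum] using h u
  have := congrArg (fun p => Polynomial.coeff p i) hp
  simpa [Polynomial.finsetSum_coeff, Polynomial.coeff_C_mul, Polynomial.coeff_X_pow, hi] using this

/-- A harmonic zonal sum is determined by its leading coefficient. -/
theorem zonalSum_one_eq_zero (hn : 3 ≤ n) {η : EuclideanSpace ℂ (Fin n)} (hη : ‖η‖ = 1)
    {k j : ℕ} {a : ℕ → ℂ} (h : laplacian n (zonalSum 1 η k j a) = 0) (h0 : a 0 = 0) :
    zonalSum 1 η k j a = 0 := by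
  obtain ⟨e, he, hηe⟩ := exists_norm_eq_one_inner_eq_zero (by omega) η
  rw [laplacian_zonalSum (one_mul 1) hη] at h
  have hrec := fun i (hi : i < min k j) => coeff_eq_zero_of_sum_mul_pow_eq_zero (m := min k j)
    (d := fun i => 4 * (a (i + 1) * ((i + 1) * (n - 1 + i + (1 - 1) * (k + j - 2 * (i + 1)))) +
          a i * ((k - i) * (j - i)))) (fun u => by
      obtain ⟨x, hW, hV, hD⟩ := exists_eval_quadForm_eq hη he hηe 1 u
      have := congrArg (eval x) h
      rw [map_sum, map_zero] at this
      rw [← this]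
      refine Finset.sum_congr rfl fun i _ => ?_
      rw [(eval x).map_mul, eval_C, (eval x).map_mul, (eval x).map_mul, (eval x).map_pow,
        (eval x).map_pow, (eval x).map_pow, hW, hV, hD]
      simp) hi
  have ha : ∀ i ≤ min k j, a i = 0 := by
    intro i
    induction i with
    | zero => exact fun _ => h0
    | succ i ih =>
      intro hi
      have h1 := hrec i hi
      rw [ih (by omega)] at h1
      -- The factor of `a (i + 1)` in the recurrence never vanishes, so `a i = 0` propagates
      -- upwards.
      have h2 : ((i : ℂ) + 1) * (n - 1 + i) ≠ 0 := by
        have : ((i : ℂ) + 1) * (n - 1 + i) = (((i + 1) * (n - 1 + i) : ℕ) : ℂ) := by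
          push_cast [Nat.cast_sub (show 1 ≤ n by omega)]
          ring
        rw [this, Nat.cast_ne_zero]
        exact Nat.mul_ne_zero (by omega) (by omega)
      have h3 : a (i + 1) * (((i : ℂ) + 1) * (n - 1 + i)) = 0 := by linear_combination h1 / 4
      exact (mul_eq_zero.mp h3).resolve_right h2
  refine Finset.sum_eq_zero fun i hi => ?_
  rw [ha i (by simpa [Nat.lt_succ_iff] using hi)]
  simp

theorem zonalSum_zero_ne_zero (hn : 2 ≤ n) {η : EuclideanSpace ℂ (Fin n)} (hη : ‖η‖ = 1)
    {k j : ℕ} {a : ℕ → ℂ} (h0 : a 0 ≠ 0) : zonalSum 0 η k j a ≠ 0 := by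
  intro h
  obtain ⟨e, he, hηe⟩ := exists_norm_eq_one_inner_eq_zero hn η
  -- With `s = -1` and `τ = 0` the form `|z|²` vanishes, and only the term `a 0` survives.
  obtain ⟨x, hW, hV, hD⟩ := exists_eval_quadForm_eq hη he hηe 0 (-1)
  have := congrArg (eval x) h
  rw [zonalSum, map_sum, map_zero, Finset.sum_range_succ'] at this
  simp [hW, hV, hD, h0] at this

/-! ### Restriction to a plane through the pole -/

/-- The restriction of a polynomial to the plane spanned by `η` and `e`. -/
noncomputable def planeRestrict (η e : EuclideanSpace ℂ (Fin n)) : ConjPoly n →ₐ[ℂ] ConjPoly 2 :=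
  bind₁ (Sum.elim (fun i => C (η i) * X (Sum.inl 0) + C (e i) * X (Sum.inl 1))
    (fun i => C (conj (η i)) * X (Sum.inr 0) + C (conj (e i)) * X (Sum.inr 1)))

theorem value_planeRestrict (η e : EuclideanSpace ℂ (Fin n)) (P : ConjPoly n)
    (u : EuclideanSpace ℂ (Fin 2)) :
    value (planeRestrict η e P) u = value P (u 0 • η + u 1 • e) := by
  rw [value, value]
  change eval₂Hom (RingHom.id ℂ) _ (bind₁ _ P) = _
  rw [eval₂Hom_bind₁]
  change eval _ P = eval _ P
  congr 2
  funext s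
  rcases s with i | i <;> simp [mul_comm]

/-- The exponent of `wᵏ⁻ⁱ w̄ʲ⁻ⁱ (s s̄)ⁱ`. -/
noncomputable def planeExponent (k j i : ℕ) : Fin 2 ⊕ Fin 2 →₀ ℕ :=
  Finsupp.equivFunOnFinite.symm (Sum.elim ![k - i, i] ![j - i, i])

/-- Three linear relations pin down the exponents: unit scalars on the plane fix the difference of
the holomorphic and antiholomorphic degrees, scaling by `2` fixes their sum, and rotating the
`e`-coordinate alone, allowed by the isotropy group, makes the two exponents of that coordinate
equal. -/
theorem eq_planeExponent (hn : 3 ≤ n) {k j : ℕ} {η e : EuclideanSpace ℂ (Fin n)}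
    (hη : ‖η‖ = 1) (hηe : ⟪η, e⟫_ℂ = 0) {P : ConjPoly n}
    (hP : P ∈ bihomogeneous n k j) (hz : IsZonal η P) {m : Fin 2 ⊕ Fin 2 →₀ ℕ}
    (hm : coeff m (planeRestrict η e P) ≠ 0) :
    m (Sum.inl 1) ≤ min k j ∧ m = planeExponent k j (m (Sum.inl 1)) := by
  have h1 : ∀ l : ℂ, l ^ (m (Sum.inl 0) + m (Sum.inl 1)) *
      conj l ^ (m (Sum.inr 0) + m (Sum.inr 1)) = l ^ k * conj l ^ j := by
    intro l
    have := weight_eq_of_coeff_ne_zero (fun _ => l) (l ^ k * conj l ^ j) (fun z => by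
      rw [value_planeRestrict, value_planeRestrict, ← hP, smul_add, smul_smul, smul_smul]) hm
    rw [← this, Fin.prod_univ_two]
    ring
  have h2 : ∀ l : ℂ, ‖l‖ = 1 →
      l ^ m (Sum.inl 1) * conj l ^ m (Sum.inr 1) = l ^ 0 * conj l ^ 0 := by
    intro l hl
    have := weight_eq_of_coeff_ne_zero ![1, l] 1 (fun z => by
      rw [value_planeRestrict, value_planeRestrict, one_mul]
      simp only [Matrix.cons_val_zero, Matrix.cons_val_one, one_mul]
      refine value_eq_of_inner_eq_of_norm_eq hn hη hP hz _ ?_ ?_ ?_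
      · rw [inner_smul_right, hηe, mul_zero]
      · rw [inner_smul_right, hηe, mul_zero]
      · simp [norm_smul, hl]) hm
    simpa [Fin.prod_univ_two] using this
  have e1 := eq_of_forall_pow_mul_conj_pow fun l _ => h1 l
  have e2 := eq_of_forall_pow_mul_conj_pow h2
  have e3 : m (Sum.inl 0) + m (Sum.inl 1) + (m (Sum.inr 0) + m (Sum.inr 1)) = k + j := by
    have := h1 2
    rw [show conj (2 : ℂ) = 2 from map_ofNat _ 2, ← pow_add, ← pow_add] at this
    exact Nat.pow_right_injective le_rfl (by exact_mod_cast this)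
  refine ⟨by omega, ?_⟩
  ext s
  rcases s with s | s <;> fin_cases s <;> simp [planeExponent] <;> omega

theorem exists_value_plane_eq (hn : 3 ≤ n) {k j : ℕ} {η e : EuclideanSpace ℂ (Fin n)}
    (hη : ‖η‖ = 1) (hηe : ⟪η, e⟫_ℂ = 0) {P : ConjPoly n}
    (hP : P ∈ bihomogeneous n k j) (hz : IsZonal η P) :
    ∃ a : ℕ → ℂ, ∀ w s : ℂ, value P (w • η + s • e) =
      ∑ i ∈ Finset.range (min k j + 1), a i * ((s * conj s) ^ i * (w ^ (k - i) * conj w ^ (j - i))) := by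
  refine ⟨fun i => coeff (planeExponent k j i) (planeRestrict η e P), fun w s => ?_⟩
  have hv := value_planeRestrict η e P !₂[w, s]
  simp only [Matrix.cons_val_zero, Matrix.cons_val_one] at hv
  have hinj : Function.Injective (planeExponent k j) := by
    intro a b hab
    have := DFunLike.congr_fun hab (Sum.inl 1)
    simpa [planeExponent] using this
  rw [← hv, value, eval_eq', Finset.sum_subset
    (s₂ := (Finset.range (min k j + 1)).image (planeExponent k j)), Finset.sum_image hinj.injOn]
  · refine Finset.sum_congr rfl fun i _ => ?_
    congr 1
    simp [planeExponent, Fin.prod_univ_two, mul_pow]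
    ring
  · intro m hm
    obtain ⟨h1, h2⟩ := eq_planeExponent hn hη hηe hP hz (mem_support_iff.mp hm)
    exact Finset.mem_image.mpr ⟨_, Finset.mem_range.mpr (by omega), h2.symm⟩
  · intro m _ hm
    rw [notMem_support_iff.mp hm, zero_mul]

theorem exists_eq_zonalSum (hn : 3 ≤ n) {k j : ℕ} {η : EuclideanSpace ℂ (Fin n)} (hη : ‖η‖ = 1)
    {P : ConjPoly n} (hP : P ∈ bihomogeneous n k j) (hz : IsZonal η P) :
    ∃ a : ℕ → ℂ, P = zonalSum 1 η k j a := by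
  obtain ⟨e, he, hηe⟩ := exists_norm_eq_one_inner_eq_zero (by omega) η
  obtain ⟨a, ha⟩ := exists_value_plane_eq hn hη hηe hP hz
  refine ⟨a, value_injective (funext fun z => ?_)⟩
  set w : ℂ := ⟪η, z⟫_ℂ with hw
  have hx : ⟪η, z - w • η⟫_ℂ = 0 := by
    rw [inner_sub_right, inner_smul_right, inner_self_eq_norm_sq_to_K, hη, ← hw]
    simp
  have hzx : z = w • η + (z - w • η) := by abel
  have hnorm : (‖z‖ : ℂ) ^ 2 = w * conj w + (‖z - w • η‖ : ℂ) ^ 2 := by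
    have h := norm_add_sq (𝕜 := ℂ) (w • η) (z - w • η)
    rw [← hzx, inner_smul_left, hx, norm_smul, hη] at h
    rw [Complex.mul_conj']
    exact_mod_cast (by simpa using h)
  rw [value_zonalSum]
  conv_lhs => rw [hzx]
  -- The component of `z` orthogonal to `η` may be replaced by the multiple of `e` of the same norm,
  -- which moves the point into the plane.
  rw [value_eq_of_inner_eq_of_norm_eq hn hη hP hz w hx
    (y := (‖z - w • η‖ : ℂ) • e) (by rw [inner_smul_right, hηe, mul_zero])
    (by simp [norm_smul, he]), ha]
  refine Finset.sum_congr rfl fun i _ => ?_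
  rw [hnorm, Complex.conj_ofReal, one_mul, ← hw, add_sub_cancel_left, sq]

/-! ### The hypergeometric zonal harmonic -/

/-- The hypergeometric coefficients of the zonal solid harmonic of bidegree `(k, j)`. -/
noncomputable def zonalCoeff (n k j i : ℕ) : ℂ :=
  ((ordinaryHypergeometricCoefficient (-(k : ℝ)) (-(j : ℝ)) (-((n : ℝ) - 2) - k - j) i : ℝ) : ℂ)

theorem zonalCoeff_zero (n k j : ℕ) : zonalCoeff n k j 0 = 1 := by
  simp [zonalCoeff, ordinaryHypergeometricCoefficient]

/-- This is the ratio of consecutive hypergeometric coefficients with denominators cleared. The new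
denominator factor `-α - k - j + i` is negative because `i < k`. -/
theorem zonalCoeff_succ (hn : 2 ≤ n) {k j i : ℕ} (hi : i < min k j) :
    zonalCoeff n k j (i + 1) * ((i + 1) * (n - 2 + k + j - i)) +
      zonalCoeff n k j i * ((k - i) * (j - i)) = 0 := by
  have hne : -((n : ℝ) - 2) - k - j + i ≠ 0 := by
    have h1 : (2 : ℝ) ≤ n := by exact_mod_cast hn
    have h2 : (i : ℝ) < k := by exact_mod_cast lt_of_lt_of_le hi (min_le_left _ _)
    have h3 : (0 : ℝ) ≤ j := Nat.cast_nonneg j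
    intro h
    linarith
  have h4 : (i : ℝ) + 1 ≠ 0 := by positivity
  have key : ordinaryHypergeometricCoefficient (-(k : ℝ)) (-(j : ℝ)) (-((n : ℝ) - 2) - k - j) (i + 1)
        * ((i + 1) * (n - 2 + k + j - i)) +
      ordinaryHypergeometricCoefficient (-(k : ℝ)) (-(j : ℝ)) (-((n : ℝ) - 2) - k - j) i
        * ((k - i) * (j - i)) = 0 := by
    rw [ordinaryHypergeometricCoefficient, ordinaryHypergeometricCoefficient,
      ascPochhammer_succ_eval, ascPochhammer_succ_eval, ascPochhammer_succ_eval,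
      Nat.factorial_succ, Nat.cast_mul, mul_inv, mul_inv, Nat.cast_add_one,
      show (n : ℝ) - 2 + k + j - i = -(-((n : ℝ) - 2) - k - j + i) by ring]
    generalize -((n : ℝ) - 2) - k - j + i = γ at hne ⊢
    field_simp
    ring
  unfold zonalCoeff
  exact_mod_cast congrArg ((↑) : ℝ → ℂ) key

theorem laplacian_zonalSum_zonalCoeff (hn : 2 ≤ n) {η : EuclideanSpace ℂ (Fin n)} (hη : ‖η‖ = 1)
    (k j : ℕ) : laplacian n (zonalSum 0 η k j (zonalCoeff n k j)) = 0 := by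
  rw [laplacian_zonalSum (zero_mul 0) hη]
  refine Finset.sum_eq_zero fun i hi => ?_
  have h := zonalCoeff_succ hn (Finset.mem_range.mp hi)
  rw [show (4 * (zonalCoeff n k j (i + 1) *
      ((i + 1) * (n - 0 + i + (1 - 0) * (k + j - 2 * (i + 1)))) +
      zonalCoeff n k j i * ((k - i) * (j - i))) : ℂ) = 0 by linear_combination 4 * h,
    C_0, zero_mul]

theorem zonalExpr_eq_sum (k j : ℕ) {η z : EuclideanSpace ℂ (Fin n)} (hz : ⟪η, z⟫_ℂ ≠ 0) :
    zonalExpr k j η z = ∑ i ∈ Finset.range (min k j + 1), zonalCoeff n k j i *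
      (((‖z‖ : ℂ) ^ 2) ^ i * (⟪η, z⟫_ℂ ^ (k - i) * conj ⟪η, z⟫_ℂ ^ (j - i))) := by
  have hx : ((1 / ‖⟪η, ‖z‖⁻¹ • z⟫_ℂ‖ ^ 2 : ℝ) : ℂ) =
      (‖z‖ : ℂ) ^ 2 / (⟪η, z⟫_ℂ * conj ⟪η, z⟫_ℂ) := by
    rw [Complex.mul_conj', ← Complex.coe_smul, inner_smul_right, norm_mul, Complex.norm_real,
      norm_inv, norm_norm]
    push_cast
    rw [mul_pow, inv_pow, one_div, mul_inv, inv_inv, div_eq_mul_inv]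
  rw [zonalExpr, ordinaryHypergeometric_eq_tsum]
  beta_reduce
  rw [tsum_eq_sum (s := Finset.range (min k j + 1)), Complex.ofReal_sum, Finset.mul_sum]
  · refine Finset.sum_congr rfl fun i hi => ?_
    have hi' : i ≤ min k j := by simpa [Nat.lt_succ_iff] using hi
    have hc : conj ⟪η, z⟫_ℂ ≠ 0 := (map_ne_zero _).mpr hz
    rw [smul_eq_mul, Complex.ofReal_mul, Complex.ofReal_pow, hx]
    change _ * (zonalCoeff n k j i * _) = _
    obtain ⟨k', rfl⟩ := Nat.exists_eq_add_of_le (show i ≤ k by omega)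
    obtain ⟨j', rfl⟩ := Nat.exists_eq_add_of_le (show i ≤ j by omega)
    rw [Nat.add_sub_cancel_left, Nat.add_sub_cancel_left, div_pow, mul_pow, pow_add, pow_add]
    field_simp
  · intro i hi
    have hi' : min k j < i := by rw [Finset.mem_range] at hi; omega
    -- A Pochhammer symbol in the numerator vanishes, which kills the term even when `(-α - k - j)ᵢ
    -- = 0` and its inverse has the default value `0`.
    rcases min_lt_iff.mp hi' with h | h <;> simp [ascPochhammer_eval_neg_coe_nat_of_lt h]

end ConjPoly

/-! ### Existence and uniqueness -/

theorem mainTheorem7 (n : ℕ) (hn : 3 ≤ n) (η : EuclideanSpace ℂ (Fin n)) (hη : ‖η‖ = 1)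
    (k j : ℕ) :
    ∃ Z : ConjPoly n,
      Z ∈ ConjPoly.solidHarmonics n k j ∧ ConjPoly.IsZonal η Z ∧ Z ≠ 0 ∧
      (∀ z : EuclideanSpace ℂ (Fin n), inner ℂ η z ≠ 0 →
        ConjPoly.value Z z = zonalExpr k j η z) ∧
      ∀ P ∈ ConjPoly.solidHarmonics n k j, ConjPoly.IsZonal η P → ∃ c : ℂ, P = c • Z := by
  have hlap := ConjPoly.laplacian_zonalSum_zonalCoeff (by omega) hη k j
  have hZb := ConjPoly.zonalSum_mem_bihomogeneous 0 η k j (ConjPoly.zonalCoeff n k j)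
  have hZz := ConjPoly.isZonal_zonalSum 0 η k j (ConjPoly.zonalCoeff n k j)
  have hZ0 : ConjPoly.zonalSum 0 η k j (ConjPoly.zonalCoeff n k j) ≠ 0 :=
    ConjPoly.zonalSum_zero_ne_zero (by omega) hη (by simp [ConjPoly.zonalCoeff_zero])
  refine ⟨ConjPoly.zonalSum 0 η k j (ConjPoly.zonalCoeff n k j), ⟨hlap, hZb⟩, hZz, hZ0, ?_, ?_⟩
  · intro z hz
    rw [ConjPoly.value_zonalSum, ConjPoly.zonalExpr_eq_sum k j hz]
    simp only [zero_mul, sub_zero]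
  · rintro P ⟨hPl, hPb⟩ hPz
    -- The harmonic built with `τ = 0` is re-expanded with `τ = 1`, so that its leading coefficient
    -- can be compared with that of `P`.
    obtain ⟨b, hb⟩ := ConjPoly.exists_eq_zonalSum hn hη hZb hZz
    obtain ⟨a, ha⟩ := ConjPoly.exists_eq_zonalSum hn hη hPb hPz
    rw [hb] at hlap hZ0 ⊢
    have hb0 : b 0 ≠ 0 := fun h => hZ0 (ConjPoly.zonalSum_one_eq_zero hn hη hlap h)
    -- This scalar cancels the leading coefficient of the difference, which is harmonic and
    -- therefore zero.
    refine ⟨a 0 / b 0, ?_⟩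
    rw [← sub_eq_zero, ha, ← ConjPoly.zonalSum_sub_smul]
    refine ConjPoly.zonalSum_one_eq_zero hn hη ?_ (by field_simp; ring)
    rw [ConjPoly.zonalSum_sub_smul, map_sub, map_smul, hlap, ← ha, LinearMap.mem_ker.mp hPl]
    simp
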